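/- Let $E$ and $F$ be real Banach lattices, let $T:E\to F$ be a regular operator (that is, a difference of two positive linear operators), and let $x\in E_+$. Let $I_x=\{y\in E:\ |y|\le\lambda x \text{ for some } \lambda\ge 0\}$ be the principal ideal generated by $x$, with the vector and lattice operations of $E$ and the order-unit norm $\|y\|_x=\inf\{\lambda\ge 0:\ |y|\le\lambda x\}$; this is a Banach lattice. Then the restriction $T:(I_x,\|\cdot\|_x)\to F$ is order $M$-weakly compact, that is, it is bounded and $f_n(Tx_n)\to 0$ for every order bounded sequence $(f_n)$ in the norm dual $F^*$ and every disjoint $\|\cdot\|_x$-bounded sequence $(x_n)$ in $I_x$. -/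

import Mathlib

open Filter Topology

set_option linter.unusedSectionVars false

/-! ### Order intervals of the norm dual, regular operators, order M-weakly compact operators -/

/-- The canonical order of the norm dual of a Banach lattice: `f ≤ g` if and only if
`f y ≤ g y` for every positive `y`. -/
def DualLE {F : Type*} [NormedAddCommGroup F] [NormedSpace ℝ F] [Lattice F]
    (f g : StrongDual ℝ F) : Prop :=
  ∀ y : F, 0 ≤ y → f y ≤ g y

/-- A sequence in the norm dual is order bounded if it lies in some order interval `[g, h]`. -/
def DualOrderBounded {F : Type*} [NormedAddCommGroup F] [NormedSpace ℝ F] [Lattice F]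
    (f : ℕ → StrongDual ℝ F) : Prop :=
  ∃ g h : StrongDual ℝ F, ∀ n, DualLE g (f n) ∧ DualLE (f n) h

/-- A linear map between vector lattices is positive if it maps positive vectors
to positive vectors. -/
def IsPositiveOperator {E F : Type*} [AddCommGroup E] [Module ℝ E] [Lattice E]
    [AddCommGroup F] [Module ℝ F] [Lattice F] (T : E →ₗ[ℝ] F) : Prop :=
  ∀ y : E, 0 ≤ y → 0 ≤ T y

/-- A linear map is regular if it is the difference of two positive linear maps. -/
def IsRegularOperator {E F : Type*} [AddCommGroup E] [Module ℝ E] [Lattice E]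
    [AddCommGroup F] [Module ℝ F] [Lattice F] (T : E →ₗ[ℝ] F) : Prop :=
  ∃ S R : E →ₗ[ℝ] F, IsPositiveOperator S ∧ IsPositiveOperator R ∧ T = S - R

/-- A sequence in a vector lattice is disjoint if its terms are pairwise disjoint. -/
def IsDisjointSeq {E : Type*} [AddCommGroup E] [Lattice E] (u : ℕ → E) : Prop :=
  ∀ m n, m ≠ n → |u m| ⊓ |u n| = 0

/-- An operator `T : E → F` between Banach lattices is order M-weakly compact if it is bounded
and `f n (T (u n)) → 0` for every order bounded sequence `f` in the norm dual of `F` and every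
disjoint norm bounded sequence `u` in `E`. -/
def IsOrderMWeaklyCompact {E F : Type*}
    [NormedAddCommGroup E] [NormedSpace ℝ E] [CompleteSpace E] [Lattice E] [HasSolidNorm E]
    [IsOrderedAddMonoid E] [IsOrderedModule ℝ E]
    [NormedAddCommGroup F] [NormedSpace ℝ F] [CompleteSpace F] [Lattice F] [HasSolidNorm F]
    [IsOrderedAddMonoid F] [IsOrderedModule ℝ F] (T : E →ₗ[ℝ] F) : Prop :=
  Continuous T ∧
    ∀ (f : ℕ → StrongDual ℝ F) (u : ℕ → E), DualOrderBounded f → IsDisjointSeq u →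
      (∃ M : ℝ, ∀ n, ‖u n‖ ≤ M) → Tendsto (fun n => f n (T (u n))) atTop (𝓝 0)

/-! ### The principal ideal generated by a vector, with its order-unit norm -/

section PrincipalIdeal

variable {E : Type*} [NormedAddCommGroup E] [NormedSpace ℝ E] [Lattice E] [HasSolidNorm E]
  [IsOrderedAddMonoid E] [IsOrderedModule ℝ E]

theorem abs_smul_le_of_abs_le {x y : E} {l : ℝ} (c : ℝ) (h : |y| ≤ l • |x|) :
    |c • y| ≤ (|c| * l) • |x| := by
  have key : ∀ a : ℝ, 0 ≤ a → ∀ z : E, |z| ≤ l • |x| → |a • z| ≤ (a * l) • |x| := by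
    intro a ha z hz
    rw [mul_smul]
    refine abs_le'.2 ⟨smul_le_smul_of_nonneg_left ((le_abs_self z).trans hz) ha, ?_⟩
    rw [← smul_neg]
    exact smul_le_smul_of_nonneg_left ((neg_le_abs z).trans hz) ha
  rcases le_total 0 c with hc | hc
  · rw [abs_of_nonneg hc]
    exact key c hc y h
  · rw [abs_of_nonpos hc, ← abs_neg, ← neg_smul]
    exact key (-c) (neg_nonneg.2 hc) y h

theorem abs_add_le_of_abs_le {x y z : E} {l m : ℝ} (hy : |y| ≤ l • |x|) (hz : |z| ≤ m • |x|) :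
    |y + z| ≤ (l + m) • |x| := by
  rw [add_smul]
  exact (abs_add_le y z).trans (add_le_add hy hz)

/-- The ideal of `E` generated by `x`: all `y` with `|y| ≤ l • |x|` for some real `l ≥ 0`. -/
def principalIdealSubmodule (x : E) : Submodule ℝ E where
  carrier := {y | ∃ l : ℝ, 0 ≤ l ∧ |y| ≤ l • |x|}
  zero_mem' := ⟨0, le_rfl, by simp⟩
  add_mem' := by
    rintro y z ⟨l, hl, hy⟩ ⟨m, hm, hz⟩
    exact ⟨l + m, add_nonneg hl hm, abs_add_le_of_abs_le hy hz⟩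
  smul_mem' := by
    rintro c y ⟨l, hl, hy⟩
    exact ⟨|c| * l, mul_nonneg (abs_nonneg c) hl, abs_smul_le_of_abs_le c hy⟩

/-- The ideal generated by `x` as a type of its own, so that it does not inherit the norm
of `E`. -/
def PrincipalIdeal (x : E) : Type _ := {y : E // y ∈ principalIdealSubmodule x}

namespace PrincipalIdeal

variable {x : E}

instance : AddCommGroup (PrincipalIdeal x) :=
  inferInstanceAs (AddCommGroup (principalIdealSubmodule x))

instance : Module ℝ (PrincipalIdeal x) :=
  inferInstanceAs (Module ℝ (principalIdealSubmodule x))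

theorem sup_mem {y z : E} (hy : y ∈ principalIdealSubmodule x)
    (hz : z ∈ principalIdealSubmodule x) : y ⊔ z ∈ principalIdealSubmodule x := by
  obtain ⟨l, hl, hy⟩ := hy
  obtain ⟨m, hm, hz⟩ := hz
  have h1 : |y| ≤ (l + m) • |x| := by
    rw [add_smul]
    exact hy.trans (le_add_of_nonneg_right (smul_nonneg hm (abs_nonneg x)))
  have h2 : |z| ≤ (l + m) • |x| := by
    rw [add_smul]
    exact hz.trans (le_add_of_nonneg_left (smul_nonneg hl (abs_nonneg x)))
  refine ⟨l + m, add_nonneg hl hm, abs_le'.2 ⟨?_, ?_⟩⟩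
  · exact sup_le ((le_abs_self y).trans h1) ((le_abs_self z).trans h2)
  · exact (neg_le_neg le_sup_left).trans ((neg_le_abs y).trans h1)

theorem inf_mem {y z : E} (hy : y ∈ principalIdealSubmodule x)
    (hz : z ∈ principalIdealSubmodule x) : y ⊓ z ∈ principalIdealSubmodule x := by
  have h := sup_mem (neg_mem hy) (neg_mem hz)
  rw [← neg_inf] at h
  exact neg_mem_iff.1 h

/-- The order and the lattice operations are those of `E`. -/
instance : Lattice (PrincipalIdeal x) :=
  Subtype.lattice (P := fun y => y ∈ principalIdealSubmodule x)
    (fun _ _ hy hz => sup_mem hy hz) (fun _ _ hy hz => inf_mem hy hz)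

variable (x) in
/-- The inclusion of the ideal generated by `x` into `E`. -/
def incl : PrincipalIdeal x →ₗ[ℝ] E := (principalIdealSubmodule x).subtype

theorem incl_injective : Function.Injective (incl x) := Subtype.val_injective

theorem incl_le {y z : PrincipalIdeal x} : incl x y ≤ incl x z ↔ y ≤ z := Iff.rfl

theorem incl_sup (y z : PrincipalIdeal x) : incl x (y ⊔ z) = incl x y ⊔ incl x z := rfl

theorem incl_abs (y : PrincipalIdeal x) : incl x |y| = |incl x y| := by
  change incl x (y ⊔ -y) = incl x y ⊔ -incl x y
  rw [incl_sup, map_neg]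

/-- The order-unit norm `‖y‖ = inf {l ≥ 0 : |y| ≤ l • |x|}`. -/
noncomputable instance : Norm (PrincipalIdeal x) :=
  ⟨fun y => sInf {l : ℝ | 0 ≤ l ∧ |incl x y| ≤ l • |x|}⟩

theorem norm_def (y : PrincipalIdeal x) :
    ‖y‖ = sInf {l : ℝ | 0 ≤ l ∧ |incl x y| ≤ l • |x|} := rfl

theorem norm_le_of_abs_le {y : PrincipalIdeal x} {l : ℝ} (hl : 0 ≤ l)
    (h : |incl x y| ≤ l • |x|) : ‖y‖ ≤ l :=
  csInf_le ⟨0, fun _ hm => hm.1⟩ ⟨hl, h⟩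

theorem norm_nonneg' (y : PrincipalIdeal x) : 0 ≤ ‖y‖ :=
  Real.sInf_nonneg fun _ hm => hm.1

theorem abs_le_norm_smul (y : PrincipalIdeal x) : |incl x y| ≤ ‖y‖ • |x| := by
  have hcl : IsClosed {l : ℝ | 0 ≤ l ∧ |incl x y| ≤ l • |x|} :=
    (isClosed_le continuous_const continuous_id).inter
      (isClosed_le continuous_const (continuous_id.smul continuous_const))
  have hne : {l : ℝ | 0 ≤ l ∧ |incl x y| ≤ l • |x|}.Nonempty := y.2
  exact (hcl.csInf_mem hne ⟨0, fun _ hm => hm.1⟩).2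

theorem norm_smul_le' (c : ℝ) (y : PrincipalIdeal x) : ‖c • y‖ ≤ |c| * ‖y‖ := by
  refine norm_le_of_abs_le (mul_nonneg (abs_nonneg c) (norm_nonneg' y)) ?_
  rw [map_smul]
  exact abs_smul_le_of_abs_le c (abs_le_norm_smul y)

theorem core : NormedSpace.Core ℝ (PrincipalIdeal x) where
  norm_nonneg := norm_nonneg'
  norm_smul c y := by
    rw [Real.norm_eq_abs]
    refine le_antisymm (norm_smul_le' c y) ?_
    rcases eq_or_ne c 0 with rfl | hc
    · rw [abs_zero, zero_mul]
      exact norm_nonneg' _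
    · have h := norm_smul_le' c⁻¹ (c • y)
      rw [inv_smul_smul₀ hc, abs_inv] at h
      have hc' : 0 < |c| := abs_pos.2 hc
      rwa [inv_mul_eq_div, le_div_iff₀ hc', mul_comm] at h
  norm_triangle y z := by
    refine norm_le_of_abs_le (add_nonneg (norm_nonneg' y) (norm_nonneg' z)) ?_
    rw [map_add]
    exact abs_add_le_of_abs_le (abs_le_norm_smul y) (abs_le_norm_smul z)
  norm_eq_zero_iff y := by
    constructor
    · intro h
      have h1 := abs_le_norm_smul y
      rw [h, zero_smul] at h1
      have h2 : ‖incl x y‖ ≤ ‖(0 : E)‖ := HasSolidNorm.solid (by simpa using h1)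
      rw [norm_zero, norm_le_zero_iff] at h2
      exact incl_injective (h2.trans (map_zero _).symm)
    · rintro rfl
      exact le_antisymm (norm_le_of_abs_le le_rfl (by simp)) (norm_nonneg' _)

noncomputable instance : NormedAddCommGroup (PrincipalIdeal x) :=
  NormedAddCommGroup.ofCore core

noncomputable instance : NormedSpace ℝ (PrincipalIdeal x) :=
  NormedSpace.ofCore core

instance : IsOrderedAddMonoid (PrincipalIdeal x) where
  add_le_add_left y z h w := by
    rw [← incl_le, map_add, map_add]
    exact add_le_add_left (incl_le.2 h) _

instance : IsOrderedModule ℝ (PrincipalIdeal x) where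
  smul_le_smul_of_nonneg_left a ha y z h := by
    rw [← incl_le, map_smul, map_smul]
    exact smul_le_smul_of_nonneg_left (incl_le.2 h) ha
  smul_le_smul_of_nonneg_right y hy a b h := by
    rw [← incl_le, map_smul, map_smul]
    refine smul_le_smul_of_nonneg_right h ?_
    rw [← map_zero (incl x)]
    exact incl_le.2 hy

instance : HasSolidNorm (PrincipalIdeal x) where
  solid y z h := by
    rw [← incl_le, incl_abs, incl_abs] at h
    exact norm_le_of_abs_le (norm_nonneg z) (h.trans (abs_le_norm_smul z))

theorem norm_incl_le (y : PrincipalIdeal x) : ‖incl x y‖ ≤ ‖y‖ * ‖x‖ := by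
  have h : ‖incl x y‖ ≤ ‖‖y‖ • |x|‖ :=
    HasSolidNorm.solid ((abs_le_norm_smul y).trans (le_abs_self _))
  rwa [norm_smul, norm_norm, norm_abs_eq_norm] at h

instance [CompleteSpace E] : CompleteSpace (PrincipalIdeal x) := by
  refine Metric.complete_of_cauchySeq_tendsto fun u hu => ?_
  have hcont : LipschitzWith ‖x‖₊ (incl x) :=
    LipschitzWith.of_dist_le_mul fun y z => by
      rw [dist_eq_norm, dist_eq_norm, ← map_sub, mul_comm]
      exact norm_incl_le (y - z)
  have hu' : CauchySeq (fun n => incl x (u n)) := hcont.uniformContinuous.comp_cauchySeq hu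
  obtain ⟨a, ha⟩ := cauchySeq_tendsto_of_complete hu'
  have key : ∀ ε : ℝ, 0 < ε → ∃ N, ∀ n ≥ N, |incl x (u n) - a| ≤ ε • |x| := by
    intro ε hε
    obtain ⟨N, hN⟩ := Metric.cauchySeq_iff.1 hu ε hε
    refine ⟨N, fun n hn => ?_⟩
    have hlim : Tendsto (fun m => incl x (u n) - incl x (u m)) atTop (𝓝 (incl x (u n) - a)) :=
      tendsto_const_nhds.sub ha
    have hcl : IsClosed {z : E | |z| ≤ ε • |x|} :=
      isClosed_le (continuous_id.sup continuous_neg) continuous_const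
    refine hcl.mem_of_tendsto hlim ?_
    filter_upwards [eventually_ge_atTop N] with m hm
    have h := abs_le_norm_smul (u n - u m)
    rw [map_sub] at h
    have hd := hN n hn m hm
    rw [dist_eq_norm] at hd
    exact h.trans (smul_le_smul_of_nonneg_right hd.le (abs_nonneg x))
  have hmem : a ∈ principalIdealSubmodule x := by
    obtain ⟨N, hN⟩ := key 1 one_pos
    have h1 : incl x (u N) - a ∈ principalIdealSubmodule x := ⟨1, zero_le_one, hN N le_rfl⟩
    have h2 := sub_mem (u N).2 h1
    have h3 : (u N).1 - (incl x (u N) - a) = a := sub_sub_cancel _ _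
    rwa [h3] at h2
  obtain ⟨b, hb⟩ : ∃ b : PrincipalIdeal x, incl x b = a := ⟨⟨a, hmem⟩, rfl⟩
  refine ⟨b, Metric.tendsto_atTop.2 fun ε hε => ?_⟩
  obtain ⟨N, hN⟩ := key (ε / 2) (half_pos hε)
  refine ⟨N, fun n hn => ?_⟩
  rw [dist_eq_norm]
  refine (norm_le_of_abs_le (half_pos hε).le ?_).trans_lt (half_lt_self hε)
  rw [map_sub, hb]
  exact hN n hn

end PrincipalIdeal

/-- The restriction of a linear map on `E` to the ideal generated by `x`. -/
def restrictToPrincipalIdeal {F : Type*} [AddCommGroup F] [Module ℝ F] (T : E →ₗ[ℝ] F) (x : E) :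
    PrincipalIdeal x →ₗ[ℝ] F :=
  T ∘ₗ PrincipalIdeal.incl x

end PrincipalIdeal

/-! In the order-unit norm, a disjoint sequence bounded by `M` satisfies `|u n| ≤ M • |x|`. Finite
sums of disjoint positive vectors are suprema, so all finite sums of the `u n` with coefficients in
`[-1, 1]` have norm at most `M`. Choosing signs gives `∑ |ψ (u n)| ≤ ‖ψ‖ * M` for each continuous
functional `ψ`, so `u` is weakly null.

To pass to varying functionals `g ≤ f n ≤ h` and a positive operator `S`, split `f n = g + (f n -
g)`. The first part is a fixed functional composed with `S`; the second is dominated on `u n` by the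
fixed functional `h - g` at `S |u n|`, and `|u n|` is again disjoint and bounded. A regular operator
follows by subtraction. -/

section LatticeOrderedGroup

variable {G : Type*} [AddCommGroup G] [Lattice G] [IsOrderedAddMonoid G]

/-- Subtracting `b` from `a ⊓ (b + c)` leaves something below both `a` and `c`, hence below `0`; so
`a ⊓ (b + c)` lies below `a ⊓ b`. -/
theorem inf_add_eq_zero_of_inf_eq_zero {a b c : G} (hab : a ⊓ b = 0) (hac : a ⊓ c = 0) :
    a ⊓ (b + c) = 0 := by
  have ha : 0 ≤ a := hab ▸ inf_le_left
  have hb : 0 ≤ b := hab ▸ inf_le_right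
  have hc : 0 ≤ c := hac ▸ inf_le_right
  refine le_antisymm ?_ (le_inf ha (add_nonneg hb hc))
  have h : a ⊓ (b + c) - b ≤ 0 := by
    rw [← hac]
    refine le_inf ?_ (sub_le_iff_le_add'.2 inf_le_right)
    exact (sub_le_self _ hb).trans inf_le_left
  exact (le_inf inf_le_left (sub_nonpos.1 h)).trans hab.le

theorem inf_sum_eq_zero {ι : Type*} {a : G} (ha : 0 ≤ a) {v : ι → G} (s : Finset ι)
    (h : ∀ i ∈ s, a ⊓ v i = 0) : a ⊓ ∑ i ∈ s, v i = 0 := by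
  classical
  induction s using Finset.induction_on with
  | empty => simpa using ha
  | insert i s his ih =>
    rw [Finset.sum_insert his]
    exact inf_add_eq_zero_of_inf_eq_zero (h i (Finset.mem_insert_self i s))
      (ih fun j hj => h j (Finset.mem_insert_of_mem hj))

/-- A finite sum of pairwise disjoint positive vectors is below every positive upper bound of
its terms. -/
theorem sum_le_of_pairwise_disjoint {ι : Type*} {v : ι → G} {b : G} (hb : 0 ≤ b)
    (hv : ∀ i, 0 ≤ v i) (hd : ∀ i j, i ≠ j → v i ⊓ v j = 0) (hvb : ∀ i, v i ≤ b)
    (s : Finset ι) : ∑ i ∈ s, v i ≤ b := by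
  classical
  induction s using Finset.induction_on with
  | empty => simpa using hb
  | insert i s his ih =>
    have h0 : v i ⊓ ∑ j ∈ s, v j = 0 :=
      inf_sum_eq_zero (hv i) s fun j hj => hd i j fun hij => his (hij ▸ hj)
    -- For disjoint vectors this identity turns the sum into a supremum, which inherits the bound
    -- `b`.
    have h1 := inf_add_sup (v i) (∑ j ∈ s, v j)
    rw [h0, zero_add] at h1
    rw [Finset.sum_insert his, ← h1]
    exact sup_le (hvb i) ih

theorem abs_map_le_of_nonneg {H : Type*} [AddCommGroup H] [Lattice H] [IsOrderedAddMonoid H]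
    [Module ℝ G] [Module ℝ H] (S : G →ₗ[ℝ] H) (hS : ∀ y, 0 ≤ y → 0 ≤ S y) (y : G) :
    |S y| ≤ S |y| := by
  refine abs_le'.2 ⟨?_, ?_⟩
  · have h := hS (|y| - y) (sub_nonneg.2 (le_abs_self y))
    rwa [map_sub, sub_nonneg] at h
  · have h := hS (|y| - -y) (sub_nonneg.2 (neg_le_abs y))
    rwa [map_sub, map_neg, sub_nonneg] at h

end LatticeOrderedGroup

section PrincipalIdealOperators

variable {E F : Type*}
  [NormedAddCommGroup E] [NormedSpace ℝ E] [Lattice E] [HasSolidNorm E]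
  [IsOrderedAddMonoid E] [IsOrderedModule ℝ E]
  [NormedAddCommGroup F] [NormedSpace ℝ F] [Lattice F] [HasSolidNorm F]
  [IsOrderedAddMonoid F] [IsOrderedModule ℝ F] {x : E}

/-- The sum is dominated by `∑ |u n|`, which disjointness keeps below `M • |x|`. That the bound does
not depend on `s` is what yields summability. -/
theorem PrincipalIdeal.norm_sum_smul_le {u : ℕ → PrincipalIdeal x} (hu : IsDisjointSeq u)
    {M : ℝ} (hM : ∀ n, ‖u n‖ ≤ M) (ε : ℕ → ℝ) (hε : ∀ n, |ε n| ≤ 1) (s : Finset ℕ) :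
    ‖∑ n ∈ s, ε n • u n‖ ≤ M := by
  have hM0 : 0 ≤ M := (norm_nonneg _).trans (hM 0)
  refine PrincipalIdeal.norm_le_of_abs_le hM0 ?_
  have hbound : ∀ n, |PrincipalIdeal.incl x (u n)| ≤ M • |x| := fun n =>
    (PrincipalIdeal.abs_le_norm_smul (u n)).trans
      (smul_le_smul_of_nonneg_right (hM n) (abs_nonneg x))
  have hdisj : ∀ m n, m ≠ n →
      |PrincipalIdeal.incl x (u m)| ⊓ |PrincipalIdeal.incl x (u n)| = 0 := by
    intro m n hmn
    rw [← PrincipalIdeal.incl_abs, ← PrincipalIdeal.incl_abs]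
    exact congrArg (PrincipalIdeal.incl x) (hu m n hmn)
  have hterm : ∀ n, |ε n • PrincipalIdeal.incl x (u n)| ≤ |PrincipalIdeal.incl x (u n)| := by
    intro n
    have h := abs_smul_le_of_abs_le (x := PrincipalIdeal.incl x (u n)) (l := 1) (ε n)
      (one_smul ℝ _).ge
    refine h.trans ?_
    have h' := smul_le_smul_of_nonneg_right (hε n) (abs_nonneg (PrincipalIdeal.incl x (u n)))
    rwa [one_smul, ← mul_one |ε n|] at h'
  rw [map_sum]
  simp only [map_smul]
  calc |∑ n ∈ s, ε n • PrincipalIdeal.incl x (u n)|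
      ≤ ∑ n ∈ s, |ε n • PrincipalIdeal.incl x (u n)| :=
        Finset.le_sum_of_subadditive (fun y : E => |y|) abs_zero.le abs_add_le s _
    _ ≤ ∑ n ∈ s, |PrincipalIdeal.incl x (u n)| := Finset.sum_le_sum fun n _ => hterm n
    _ ≤ M • |x| := sum_le_of_pairwise_disjoint (smul_nonneg hM0 (abs_nonneg x))
        (fun n => abs_nonneg _) hdisj hbound s

/-- Disjoint norm bounded sequences in a principal ideal are weakly null. -/
theorem PrincipalIdeal.tendsto_apply_of_isDisjointSeq (ψ : StrongDual ℝ (PrincipalIdeal x))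
    {u : ℕ → PrincipalIdeal x} (hu : IsDisjointSeq u) {M : ℝ} (hM : ∀ n, ‖u n‖ ≤ M) :
    Tendsto (fun n => ψ (u n)) atTop (𝓝 0) := by
  have hsum : Summable fun n => |ψ (u n)| := by
    refine summable_of_sum_le (c := ‖ψ‖ * M) (fun n => abs_nonneg _) fun s => ?_
    -- These signs turn the sum of absolute values into one value of `ψ`.
    set ε : ℕ → ℝ := fun n => (SignType.sign (ψ (u n)) : ℝ)
    have hε : ∀ n, |ε n| ≤ 1 := by
      intro n
      rcases lt_trichotomy (ψ (u n)) 0 with h | h | h <;> simp [ε, h]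
    calc ∑ n ∈ s, |ψ (u n)| = ψ (∑ n ∈ s, ε n • u n) := by
          rw [map_sum]
          refine Finset.sum_congr rfl fun n _ => ?_
          rw [map_smul, smul_eq_mul, sign_mul_self]
      _ ≤ ‖ψ (∑ n ∈ s, ε n • u n)‖ := le_abs_self _
      _ ≤ ‖ψ‖ * ‖∑ n ∈ s, ε n • u n‖ := ψ.le_opNorm _
      _ ≤ ‖ψ‖ * M := mul_le_mul_of_nonneg_left
          (PrincipalIdeal.norm_sum_smul_le hu hM ε hε s) (norm_nonneg ψ)
  exact squeeze_zero_norm (fun n => le_rfl) hsum.tendsto_atTop_zero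

theorem isPositiveOperator_restrictToPrincipalIdeal {S : E →ₗ[ℝ] F} (hS : IsPositiveOperator S)
    (x : E) : IsPositiveOperator (restrictToPrincipalIdeal S x) :=
  fun _ hy => hS _ (PrincipalIdeal.incl_le.2 hy)

/-- Positivity gives `|S y| ≤ S |y| ≤ ‖y‖ • S |x|`, so `‖S |x|‖` is an explicit bound and
completeness plays no role. -/
theorem continuous_restrictToPrincipalIdeal {S : E →ₗ[ℝ] F} (hS : IsPositiveOperator S)
    (x : E) : Continuous (restrictToPrincipalIdeal S x) := by
  refine AddMonoidHomClass.continuous_of_bound (restrictToPrincipalIdeal S x) ‖S |x|‖ fun y => ?_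
  have h1 : |S (PrincipalIdeal.incl x y)| ≤ ‖y‖ • S |x| := by
    refine (abs_map_le_of_nonneg S hS _).trans ?_
    have h := hS _ (sub_nonneg.2 (PrincipalIdeal.abs_le_norm_smul y))
    rwa [map_sub, map_smul, sub_nonneg] at h
  have h2 : ‖S (PrincipalIdeal.incl x y)‖ ≤ ‖‖y‖ • S |x|‖ :=
    HasSolidNorm.solid (h1.trans (le_abs_self _))
  rwa [norm_smul, norm_norm, mul_comm] at h2

theorem tendsto_apply_restrictToPrincipalIdeal {S : E →ₗ[ℝ] F} (hS : IsPositiveOperator S)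
    {f : ℕ → StrongDual ℝ F} (hf : DualOrderBounded f) {u : ℕ → PrincipalIdeal x}
    (hu : IsDisjointSeq u) {M : ℝ} (hM : ∀ n, ‖u n‖ ≤ M) :
    Tendsto (fun n => f n (restrictToPrincipalIdeal S x (u n))) atTop (𝓝 0) := by
  obtain ⟨g, h, hgh⟩ := hf
  let S' : PrincipalIdeal x →L[ℝ] F :=
    ⟨restrictToPrincipalIdeal S x, continuous_restrictToPrincipalIdeal hS x⟩
  have hS' : ∀ y, 0 ≤ y → 0 ≤ S' y := isPositiveOperator_restrictToPrincipalIdeal hS x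
  have hu' : IsDisjointSeq fun n => |u n| := by
    intro m n hmn
    simpa only [abs_abs] using hu m n hmn
  have hlim1 : Tendsto (fun n => g (S' (u n))) atTop (𝓝 0) :=
    PrincipalIdeal.tendsto_apply_of_isDisjointSeq (g ∘L S') hu hM
  have hlim2 : Tendsto (fun n => (h - g) (S' |u n|)) atTop (𝓝 0) :=
    PrincipalIdeal.tendsto_apply_of_isDisjointSeq ((h - g) ∘L S') hu'
      fun n => (norm_abs_eq_norm (u n)).trans_le (hM n)
  -- The functional `f n - g` is positive, which moves the absolute value onto `u n`; then `f n ≤ h`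
  -- removes the dependence of the functional on `n`.
  have hdom : ∀ n, ‖(f n - g) (S' (u n))‖ ≤ (h - g) (S' |u n|) := by
    intro n
    have hpos : ∀ y, 0 ≤ y → 0 ≤ ((f n - g) ∘L S' : StrongDual ℝ (PrincipalIdeal x)) y :=
      fun y hy => sub_nonneg.2 ((hgh n).1 _ (hS' y hy))
    refine (abs_map_le_of_nonneg
      ((f n - g) ∘L S' : StrongDual ℝ (PrincipalIdeal x)).toLinearMap hpos (u n)).trans ?_
    exact sub_le_sub_right ((hgh n).2 _ (hS' _ (abs_nonneg _))) _
  have hlim3 := (squeeze_zero_norm hdom hlim2).add hlim1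
  rw [add_zero] at hlim3
  refine hlim3.congr fun n => ?_
  rw [sub_apply, sub_add_cancel]
  rfl

end PrincipalIdealOperators

theorem mainTheorem10 {E F : Type*}
    [NormedAddCommGroup E] [NormedSpace ℝ E] [CompleteSpace E] [Lattice E] [HasSolidNorm E]
    [IsOrderedAddMonoid E] [IsOrderedModule ℝ E]
    [NormedAddCommGroup F] [NormedSpace ℝ F] [CompleteSpace F] [Lattice F] [HasSolidNorm F]
    [IsOrderedAddMonoid F] [IsOrderedModule ℝ F]
    (T : E →ₗ[ℝ] F) (hT : IsRegularOperator T) (x : E) (hx : 0 ≤ x) :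
    IsOrderMWeaklyCompact (restrictToPrincipalIdeal T x) := by
  obtain ⟨S, R, hS, hR, rfl⟩ := hT
  refine ⟨(continuous_restrictToPrincipalIdeal hS x).sub
    (continuous_restrictToPrincipalIdeal hR x), fun f u hf hu ⟨M, hM⟩ => ?_⟩
  have hlim := (tendsto_apply_restrictToPrincipalIdeal hS hf hu hM).sub
    (tendsto_apply_restrictToPrincipalIdeal hR hf hu hM)
  rw [sub_zero] at hlim
  exact hlim.congr fun n => (map_sub (f n) _ _).symm
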